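/- Let $G$ be a finite connected graph, i.e. a connected $1$-dimensional CW complex with finitely many cells (multiple edges and loops are allowed), and suppose that $G$ has at least one essential vertex, i.e. a vertex of valence at least $3$ (where a loop contributes $2$ to the valence of its vertex). For $n\ge 0$ let $$\mathrm{Conf}_n(G)=\{(x_1,\dots,x_n)\in G^n : x_i\ne x_j \text{ for } i\ne j\}\subset G^n$$ be the ordered configuration space, with the subspace topology. Let $n\ge m\ge 0$ and let $\pi\colon \mathrm{Conf}_n(G)\to \mathrm{Conf}_m(G)$, $(x_1,\dots,x_n)\mapsto(x_1,\dots,x_m)$, be the forgetful map. Then there exists a continuous map $\sigma\colon \mathrm{Conf}_m(G)\to \mathrm{Conf}_n(G)$ such that $\pi\circ\sigma$ is homotopic to the identity of $\mathrm{Conf}_m(G)$. In particular, $H_*(\mathrm{Conf}_m(G))$ is a direct summand of $H_*(\mathrm{Conf}_n(G))$: for every ring $R$, every $R$-module $M$ of coefficients and every degree $i\ge 0$ there are an $R$-module $K$ and an isomorphism of $R$-modules $$H_i(\mathrm{Conf}_n(G);M)\;\cong\; H_i(\mathrm{Conf}_m(G);M)\oplus K$$ under which $\sigma_*$ is the inclusion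 of the first summand and $\pi_*$ is the projection onto it. -/

import Mathlib

open CategoryTheory Limits

universe u v

/-- A topological space `G` with a chosen CW structure is a *graph* when it is a nonempty connected
Hausdorff space and the CW structure is 1-dimensional with finitely many cells. Multiple edges
and loops are allowed. -/
class IsFiniteConnectedGraph (G : Type u) [TopologicalSpace G]
    [Topology.CWComplex (Set.univ : Set G)] : Prop where
  t2 : T2Space G
  connected : ConnectedSpace G
  finite : Topology.CWComplex.Finite (Set.univ : Set G)
  isEmpty_cell : ∀ k : ℕ, 2 ≤ k → IsEmpty (Topology.CWComplex.cell (Set.univ : Set G) k)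

section Valence

variable {G : Type u} [TopologicalSpace G] [Topology.CWComplex (Set.univ : Set G)]

/-- The point of `G` given by a vertex (a 0-cell). -/
def vertexPoint (w : Topology.CWComplex.cell (Set.univ : Set G) 0) : G :=
  Topology.CWComplex.map 0 w ![]

/-- The end at the parameter `-1` of an edge (a 1-cell, parametrized by `[-1, 1]`). -/
def edgeSource (e : Topology.CWComplex.cell (Set.univ : Set G) 1) : G :=
  Topology.CWComplex.map 1 e ![-1]

/-- The end of an edge at the parameter `1`. -/
def edgeTarget (e : Topology.CWComplex.cell (Set.univ : Set G) 1) : G :=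
  Topology.CWComplex.map 1 e ![1]

/-- The valence of a vertex: the number of ends of edges attached to it, so a loop counts twice. -/
noncomputable def valence (w : Topology.CWComplex.cell (Set.univ : Set G) 0) : ℕ :=
  {e | edgeSource e = vertexPoint w}.ncard + {e | edgeTarget e = vertexPoint w}.ncard

/-- A vertex is essential if its valence is at least 3. -/
def IsEssential (w : Topology.CWComplex.cell (Set.univ : Set G) 0) : Prop :=
  3 ≤ valence w

end Valence

/-- The ordered configuration space of `n` particles in `X`, a subspace of `Xⁿ`. -/
abbrev Conf (n : ℕ) (X : Type u) [TopologicalSpace X] : Type u :=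
  {x : Fin n → X // Function.Injective x}

/-- The map `Conf n X → Conf m X` for `m ≤ n` that forgets all but the first `m` particles. -/
def forgetParticles {m n : ℕ} (h : m ≤ n) (X : Type u) [TopologicalSpace X] :
    C(Conf n X, Conf m X) where
  toFun x := ⟨fun i => x.1 (Fin.castLE h i), x.2.comp (Fin.castLE_injective h)⟩
  continuous_toFun := by
    refine Continuous.subtype_mk (continuous_pi fun i => ?_) _
    exact (continuous_apply (Fin.castLE h i)).comp continuous_subtype_val

/-- The `i`-th singular homology of `X` with coefficients in the `R`-module `M`. -/
noncomputable abbrev singularH {R : Type v} [Ring R] (M : ModuleCat.{max u v} R) (i : ℕ)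
    (X : Type u) [TopologicalSpace X] : ModuleCat.{max u v} R :=
  ((AlgebraicTopology.singularHomologyFunctor.{u} (ModuleCat.{max u v} R) i).obj M).obj
    (TopCat.of X)

/-- The map induced on singular homology by a continuous map. -/
noncomputable abbrev singularHMap {R : Type v} [Ring R] (M : ModuleCat.{max u v} R) (i : ℕ)
    {X Y : Type u} [TopologicalSpace X] [TopologicalSpace Y] (f : C(X, Y)) :
    singularH M i X ⟶ singularH M i Y :=
  ((AlgebraicTopology.singularHomologyFunctor.{u} (ModuleCat.{max u v} R) i).obj M).map
    (TopCat.ofHom f)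

/-!
Suppose that `m` distinct particles lie on `G`. At an essential vertex choose three half-edges, and
measure the distance from the vertex by a continuous function, the height, that vanishes at the
vertex only and is the parameter on the chosen half-edges (`Tripod`, `nonempty_tripod`). Let `s` be
the second smallest height of the particles, cut off at `1`. It is positive, since at most one
particle is at the vertex, and at most one particle has height less than `s`.

A new particle is added at height at most `s / 2`, so that it can only collide with that one old
particle, say `x`. When `x` is at height `s`, the new particle is at the vertex, and as `x` moves to
the vertex, the new particle moves out along leg `0`. This works unless `x` comes in on leg `0`
itself. In that case the two particles are exchanged as at a railway junction: the new one withdraws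
to leg `2`, the old one passes to leg `1`, the new one passes to leg `0`, and the old one returns to
the vertex (`oldPos`, `newPos`, `oldPos_ne_newPos`). All formulas are homogeneous in the height and
`s`, so they remain continuous as `s` tends to `0` (`continuous_push`, `continuous_newPt`).

Forgetting the new particle leaves a map that moves only the nearest particle, on legs `0` and `1`
and never to a greater height. The straight-line homotopy on the union of these two legs deforms
the map to the identity and keeps the particles distinct
(`Tripod.forgetParticles_comp_addParticle_homotopic`). Adding particles one at a time gives `σ`. By
the homotopy invariance of singular homology `π_*` is a retraction of `σ_*`, and the kernel of `π_*`
is a complement (`exists_biprod_iso_of_comp_eq_id`).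
-/

/-! ### Tripods -/

/-- Three arcs `leg j`, parametrized by `[0, 1]` (the values outside `[0, 1]` play no role), that
issue from a common point and are otherwise disjoint, with a function `height` on the whole space
that restricts to the parameter of each arc and vanishes at the common point only. The interior of
the arc `leg 0` is required to be open; other arcs may issue from the common point. -/
structure Tripod (X : Type u) [TopologicalSpace X] where
  leg : Fin 3 → C(ℝ, X)
  height : C(X, ℝ)
  height_nonneg : ∀ x, 0 ≤ height x
  height_le_one : ∀ x, height x ≤ 1
  height_leg : ∀ j t, 0 ≤ t → t ≤ 1 → height (leg j t) = t
  eq_of_height_eq_zero : ∀ x y, height x = 0 → height y = 0 → x = y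
  leg_ne : ∀ j k t t', j ≠ k → 0 < t → t ≤ 1 → 0 ≤ t' → t' ≤ 1 → leg j t ≠ leg k t'
  isOpen_leg : IsOpen (leg 0 '' Set.Ioo 0 1)

namespace Tripod

variable {X : Type u} [TopologicalSpace X] (T : Tripod X)

/-- The common point of the three legs. -/
def center : X := T.leg 0 0

lemma height_center : T.height T.center = 0 := T.height_leg 0 0 le_rfl zero_le_one

lemma leg_zero (j : Fin 3) : T.leg j 0 = T.center :=
  T.eq_of_height_eq_zero _ _ (T.height_leg j 0 le_rfl zero_le_one) T.height_center

/-- The line that runs from the end of `leg j`, at the parameter `-1`, through the centre to the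
end of `leg 0`, at the parameter `1`. -/
noncomputable def line (j : Fin 3) (a : ℝ) : X := if 0 ≤ a then T.leg 0 a else T.leg j (-a)

lemma continuous_line (j : Fin 3) : Continuous (T.line j) := by
  refine Continuous.if_le (T.leg 0).continuous ((T.leg j).continuous.comp continuous_neg)
    continuous_const continuous_id fun a ha => ?_
  simp [← ha, leg_zero]

lemma line_of_nonneg (j : Fin 3) {a : ℝ} (h : 0 ≤ a) : T.line j a = T.leg 0 a := if_pos h

lemma line_of_neg (j : Fin 3) {a : ℝ} (h : a < 0) : T.line j a = T.leg j (-a) :=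
  if_neg (not_le.2 h)

lemma height_line (j : Fin 3) {a : ℝ} (h : |a| ≤ 1) : T.height (T.line j a) = |a| := by
  rw [abs_le] at h
  rcases le_or_gt 0 a with ha | ha
  · rw [T.line_of_nonneg j ha, T.height_leg _ _ ha h.2, abs_of_nonneg ha]
  · rw [T.line_of_neg j ha, T.height_leg _ _ (by linarith) (by linarith), abs_of_neg ha]

/-- Two of the lines share only their halves on `leg 0`. -/
lemma eq_and_nonneg_of_line_eq_line {j k : Fin 3} (hj : j ≠ 0) (hk : k ≠ 0) (hjk : j ≠ k)
    {a b : ℝ} (ha : |a| ≤ 1) (hb : |b| ≤ 1) (h : T.line j a = T.line k b) : a = b ∧ 0 ≤ a := by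
  have hab : |a| = |b| := by rw [← T.height_line j ha, ← T.height_line k hb, h]
  rw [abs_le] at ha hb
  rcases le_or_gt 0 a with ha' | ha' <;> rcases le_or_gt 0 b with hb' | hb'
  · rw [abs_of_nonneg ha', abs_of_nonneg hb'] at hab
    exact ⟨hab, ha'⟩
  · rw [T.line_of_nonneg j ha', T.line_of_neg k hb'] at h
    exact absurd h.symm
      (T.leg_ne _ _ _ _ hk (by linarith) (by linarith) ha' (by linarith))
  · rw [T.line_of_neg j ha', T.line_of_nonneg k hb'] at h
    exact absurd h (T.leg_ne _ _ _ _ hj (by linarith) (by linarith) hb' (by linarith))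
  · rw [T.line_of_neg j ha', T.line_of_neg k hb'] at h
    exact absurd h
      (T.leg_ne _ _ _ _ hjk (by linarith) (by linarith) (by linarith) (by linarith))

/-- The leg from which an old particle has to be displaced to make room for the new one. -/
def arc : Set X := T.leg 0 '' Set.Icc 0 1

lemma leg_height {x : X} (hx : x ∈ T.arc) : T.leg 0 (T.height x) = x := by
  obtain ⟨t, ht, rfl⟩ := hx
  rw [T.height_leg _ _ ht.1 ht.2]

lemma leg_mem_arc {t : ℝ} (h0 : 0 ≤ t) (h1 : t ≤ 1) : T.leg 0 t ∈ T.arc := ⟨t, ⟨h0, h1⟩, rfl⟩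

/-- A function that is continuous on `arc`, and off the interior of `arc`, is continuous if the two
formulas agree at the two ends of `arc`. -/
lemma continuous_ite_arc [T2Space X] {Y Z : Type*} [TopologicalSpace Y] [TopologicalSpace Z]
    {ξ : Y → X} (hξ : Continuous ξ) {f g : Y → Z} (hf : Continuous f) (hg : Continuous g)
    (h0 : ∀ y, T.height (ξ y) = 0 → f y = g y)
    (h1 : ∀ y, ξ y ∈ T.arc → T.height (ξ y) = 1 → f y = g y)
    [DecidablePred fun y => ξ y ∈ T.arc] :
    Continuous fun y => if ξ y ∈ T.arc then f y else g y := by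
  have hA : IsClosed {y | ξ y ∈ T.arc} :=
    ((isCompact_Icc.image (T.leg 0).continuous).isClosed).preimage hξ
  have hB : IsClosed {y | ξ y ∉ T.leg 0 '' Set.Ioo 0 1} :=
    (T.isOpen_leg.isClosed_compl).preimage hξ
  have hAB : {y | ξ y ∈ T.arc} ∪ {y | ξ y ∉ T.leg 0 '' Set.Ioo 0 1} = Set.univ := by
    ext y
    simp only [Set.mem_union, Set.mem_ofPred_eq, Set.mem_univ, iff_true]
    by_cases hy : ξ y ∈ T.leg 0 '' Set.Ioo 0 1
    · exact Or.inl (Set.image_mono Set.Ioo_subset_Icc_self hy)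
    · exact Or.inr hy
  rw [← continuousOn_univ, ← hAB]
  refine ContinuousOn.union_of_isClosed (hf.continuousOn.congr fun y hy => if_pos hy)
    (hg.continuousOn.congr fun y hy => ?_) hA hB
  by_cases hy' : ξ y ∈ T.arc
  · rw [if_pos hy']
    obtain ⟨t, ht, hty⟩ := hy'
    rcases ht.1.eq_or_lt with h | h
    · exact h0 y (by rw [← hty, T.height_leg _ _ ht.1 ht.2, h])
    · rcases ht.2.eq_or_lt with h' | h'
      · exact h1 y ⟨t, ht, hty⟩ (by rw [← hty, T.height_leg _ _ ht.1 ht.2, h'])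
      · exact absurd ⟨t, ⟨h, h'⟩, hty⟩ hy
  · exact if_neg hy'

/-! ### The exchange of two particles at the centre -/

/-- The position on `line 1` of an old particle that was at height `t` on `leg 0`, when all other
particles are at height at least `s`. As `t` decreases from `s` to `0` the particle enters `leg 1`
at `t = 2 * s / 3`, when the new particle is on `leg 2`, and returns to the centre at `t = 0`, when
the new particle is on `leg 0`. -/
noncomputable def oldPos (s t : ℝ) : ℝ := max (-t) (min t (3 * t - 2 * s))

/-- The position on `line 2` of the new particle when an old particle is at height `t ≤ s` on
`leg 0`. As `t` decreases from `s` to `0`, the new particle moves from the centre to `leg 2`, turns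
round at `t = 2 * s / 3`, enters `leg 0` at `t = s / 3`, and ends there at height `s / 2`. -/
noncomputable def newPos (s t : ℝ) : ℝ := max ((s - 3 * t) / 2) (3 * (t - s) / 2)

lemma abs_oldPos_le {s t : ℝ} (ht : 0 ≤ t) : |oldPos s t| ≤ t :=
  abs_le.2 ⟨le_max_left _ _, max_le (by linarith) (min_le_left _ _)⟩

lemma oldPos_of_le {s t : ℝ} (ht : 0 ≤ t) (h : s ≤ t) : oldPos s t = t := by
  rw [oldPos, min_eq_left (by linarith), max_eq_right (by linarith)]

lemma abs_newPos_le {s t : ℝ} (ht : 0 ≤ t) (h : t ≤ s) : |newPos s t| ≤ s / 2 := by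
  refine abs_le.2 ⟨?_, max_le (by linarith) (by linarith)⟩
  rcases le_total (3 * t) (2 * s) with h' | h'
  · exact le_max_of_le_left (by linarith)
  · exact le_max_of_le_right (by linarith)

lemma newPos_self {s : ℝ} (hs : 0 ≤ s) : newPos s s = 0 := by
  rw [newPos, sub_self, mul_zero, zero_div, max_eq_right (by linarith)]

lemma newPos_zero {s : ℝ} (hs : 0 ≤ s) : newPos s 0 = s / 2 := by
  rw [newPos, max_eq_left (by linarith), mul_zero, sub_zero]

/-- The pair of positions avoids the half of the diagonal on which the particles collide. -/
lemma oldPos_ne_newPos {s t : ℝ} (hs : 0 < s) (ht : 0 ≤ t) (h : 0 ≤ oldPos s t) :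
    oldPos s t ≠ newPos s (min t s) := by
  intro heq
  rcases le_or_gt s t with hst | hst
  · rw [oldPos_of_le ht hst, min_eq_right hst, newPos_self hs.le] at heq
    linarith
  rw [min_eq_left hst.le] at heq
  rcases ht.eq_or_lt with rfl | ht'
  · have := abs_oldPos_le (s := s) le_rfl
    rw [newPos_zero hs.le] at heq
    rw [heq, abs_of_pos (by linarith)] at this
    linarith
  · have h3 : 0 ≤ 3 * t - 2 * s := by
      rcases le_max_iff.1 h with h | h
      · linarith
      · exact (le_min_iff.1 h).2
    have : newPos s t < 0 := max_lt (by linarith) (by linarith)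
    linarith

open Classical in
/-- The old particle at `x` is moved along `leg 0` and `leg 1`, if its height is less than `s`. This
displacement, at `τ = 0`, is undone linearly as `τ` runs to `1`. -/
noncomputable def push (τ s : ℝ) (x : X) : X :=
  if x ∈ T.arc then T.line 1 ((1 - τ) * oldPos s (T.height x) + τ * T.height x) else x

open Classical in
/-- The new particle, when an old particle is at `x` and all others are at height at least `s`: at
the centre if the height of `x` is at least `s`, and at height `s / 2` on `leg 0` if `x` is the
centre. If `x` is not on `leg 0`, the new particle stays on `leg 0` in between. -/
noncomputable def newPt (s : ℝ) (x : X) : X :=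
  if x ∈ T.arc then T.line 2 (newPos s (min (T.height x) s))
  else T.line 2 ((s - min (T.height x) s) / 2)

lemma push_of_le {τ s : ℝ} {x : X} (h : s ≤ T.height x) : T.push τ s x = x := by
  rw [push]
  split_ifs with hx
  · rw [oldPos_of_le (T.height_nonneg x) h, ← add_mul, sub_add_cancel, one_mul,
      T.line_of_nonneg 1 (T.height_nonneg x), T.leg_height hx]
  · rfl

lemma push_one (s : ℝ) (x : X) : T.push 1 s x = x := by
  rw [push]
  split_ifs with hx
  · rw [sub_self, zero_mul, zero_add, one_mul,
      T.line_of_nonneg 1 (T.height_nonneg x), T.leg_height hx]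
  · rfl

lemma height_push_le {τ s : ℝ} (hτ : τ ∈ Set.Icc 0 1) (x : X) :
    T.height (T.push τ s x) ≤ T.height x := by
  rw [push]
  split_ifs with hx
  · have h0 := T.height_nonneg x
    have hp := abs_le.1 (abs_oldPos_le (s := s) h0)
    have h : |(1 - τ) * oldPos s (T.height x) + τ * T.height x| ≤ T.height x := by
      have := sub_nonneg.2 hτ.2
      refine abs_le.2 ⟨?_, ?_⟩
      · nlinarith [mul_le_mul_of_nonneg_left hp.1 this, mul_nonneg hτ.1 h0]
      · nlinarith [mul_le_mul_of_nonneg_left hp.2 this]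
    rwa [T.height_line 1 (h.trans (T.height_le_one x))]
  · exact le_rfl

lemma continuous_push [T2Space X] {Y : Type*} [TopologicalSpace Y] {τ s : Y → ℝ} {ξ : Y → X}
    (hτ : Continuous τ) (hs : Continuous s) (hξ : Continuous ξ) (hs1 : ∀ y, s y ≤ 1) :
    Continuous fun y => T.push (τ y) (s y) (ξ y) := by
  classical
  have hfix : ∀ y, T.height (ξ y) = 0 ∨ ξ y ∈ T.arc ∧ T.height (ξ y) = 1 →
      T.line 1 ((1 - τ y) * oldPos (s y) (T.height (ξ y)) + τ y * T.height (ξ y)) = ξ y := by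
    rintro y (h | ⟨hy, h⟩)
    · have := abs_oldPos_le (s := s y) (le_refl (0 : ℝ))
      rw [h, abs_nonpos_iff.1 this, mul_zero, mul_zero, add_zero]
      exact T.eq_of_height_eq_zero _ _ (by rw [T.height_line _ (by simp), abs_zero]) h
    · rw [h, oldPos_of_le zero_le_one (hs1 y), ← add_mul, sub_add_cancel, one_mul,
        T.line_of_nonneg 1 zero_le_one, ← h, T.leg_height hy]
  unfold push
  refine T.continuous_ite_arc hξ ((T.continuous_line 1).comp ?_) hξ
    (fun y hy => hfix y (Or.inl hy)) fun y hy h => hfix y (Or.inr ⟨hy, h⟩)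
  unfold oldPos
  fun_prop

lemma newPt_of_le {s : ℝ} {x : X} (hs : 0 ≤ s) (h : s ≤ T.height x) :
    T.newPt s x = T.center := by
  rw [newPt, min_eq_right h, newPos_self hs, sub_self, zero_div, ite_self,
    T.line_of_nonneg 2 le_rfl, center]

lemma height_newPt_le {s : ℝ} (hs : 0 ≤ s) (hs1 : s ≤ 1) (x : X) :
    T.height (T.newPt s x) ≤ s / 2 := by
  have h0 := le_min (T.height_nonneg x) hs
  have hle := min_le_right (T.height x) s
  rw [newPt]
  split_ifs
  · have h := abs_newPos_le h0 hle
    rwa [T.height_line 2 (by linarith)]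
  · have h : |(s - min (T.height x) s) / 2| ≤ s / 2 := abs_le.2 ⟨by linarith, by linarith⟩
    rwa [T.height_line 2 (by linarith)]

lemma continuous_newPt [T2Space X] {Y : Type*} [TopologicalSpace Y] {s : Y → ℝ} {ξ : Y → X}
    (hs : Continuous s) (hξ : Continuous ξ) (hs0 : ∀ y, 0 ≤ s y) (hs1 : ∀ y, s y ≤ 1) :
    Continuous fun y => T.newPt (s y) (ξ y) := by
  classical
  unfold newPt
  refine T.continuous_ite_arc hξ ((T.continuous_line 2).comp ?_) ((T.continuous_line 2).comp ?_)
    (fun y hy => ?_) fun y _ hy => ?_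
  · unfold newPos
    fun_prop
  · fun_prop
  · simp only [Function.comp_apply]
    rw [hy, min_eq_left (hs0 y), newPos_zero (hs0 y), sub_zero]
  · simp only [Function.comp_apply]
    rw [hy, min_eq_right (hs1 y), newPos_self (hs0 y), sub_self, zero_div]

lemma push_ne_newPt {s : ℝ} (hs : 0 < s) (hs1 : s ≤ 1) (x : X) :
    T.push 0 s x ≠ T.newPt s x := by
  have h0 := T.height_nonneg x
  have hm0 := le_min h0 hs.le
  have hms := min_le_right (T.height x) s
  rw [push, newPt]
  split_ifs with hx
  · intro h
    rw [sub_zero, one_mul, zero_mul, add_zero] at h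
    obtain ⟨h1, h2⟩ := T.eq_and_nonneg_of_line_eq_line (by decide) (by decide) (by decide)
      ((abs_oldPos_le h0).trans (T.height_le_one x))
      ((abs_newPos_le hm0 hms).trans (by linarith)) h
    exact oldPos_ne_newPos hs h0 h2 h1
  · intro h
    rw [T.line_of_nonneg 2 (by linarith)] at h
    exact hx (h ▸ T.leg_mem_arc (by linarith) (by linarith))

/-! ### Adding a particle to a configuration -/

/-- The least height of the particles other than the `i`-th, or `1` if there are none. It is always
at most `1`; the value `1` at `j = i` keeps the index set nonempty. -/
noncomputable def gap {m : ℕ} (i : Fin m) (x : Fin m → X) : ℝ :=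
  Finset.univ.inf' ⟨i, Finset.mem_univ i⟩ fun j => if j = i then 1 else T.height (x j)

section gap

variable {m : ℕ} (i : Fin m)

lemma continuous_gap : Continuous (T.gap i) := by
  refine Continuous.finset_inf'_apply _ fun j _ => ?_
  split_ifs
  · exact continuous_const
  · exact T.height.continuous.comp (continuous_apply j)

lemma gap_le_one (x : Fin m → X) : T.gap i x ≤ 1 :=
  (Finset.inf'_le _ (Finset.mem_univ i)).trans (if_pos rfl).le

lemma gap_le {j : Fin m} (h : j ≠ i) (x : Fin m → X) : T.gap i x ≤ T.height (x j) :=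
  (Finset.inf'_le _ (Finset.mem_univ j)).trans (if_neg h).le

lemma le_gap {a : ℝ} {x : Fin m → X} (h1 : a ≤ 1) (h : ∀ j, j ≠ i → a ≤ T.height (x j)) :
    a ≤ T.gap i x := by
  refine Finset.le_inf' _ _ fun j _ => ?_
  split_ifs with hj
  exacts [h1, h j hj]

lemma gap_nonneg (x : Fin m → X) : 0 ≤ T.gap i x :=
  T.le_gap i zero_le_one fun _ _ => T.height_nonneg _

/-- As two particles are never both at the centre, the gap of a nearest particle is positive. -/
lemma gap_pos {x : Fin m → X} (hx : Function.Injective x) (h : T.height (x i) ≤ T.gap i x) :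
    0 < T.gap i x := by
  refine (T.gap_nonneg i x).lt_of_ne fun h0 => ?_
  obtain ⟨j, -, hj⟩ := Finset.exists_mem_eq_inf' (s := Finset.univ) ⟨i, Finset.mem_univ i⟩
    fun j => if j = i then 1 else T.height (x j)
  change T.gap i x = _ at hj
  rw [← h0] at hj h
  split_ifs at hj with hji
  · exact one_ne_zero hj.symm
  · exact hji (hx (T.eq_of_height_eq_zero _ _ hj.symm (h.antisymm (T.height_nonneg _))))

end gap

/-- At most one particle is displaced, and only closer to the centre than all the others. -/
lemma injective_push {m : ℕ} {τ : ℝ} (hτ : τ ∈ Set.Icc 0 1) {x : Fin m → X}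
    (hx : Function.Injective x) : Function.Injective fun i => T.push τ (T.gap i x) (x i) := by
  have key : ∀ i j, i ≠ j → T.height (x i) ≤ T.height (x j) →
      T.push τ (T.gap i x) (x i) ≠ T.push τ (T.gap j x) (x j) := by
    intro i j hij hle h
    rw [T.push_of_le ((T.gap_le j hij x).trans hle)] at h
    rcases le_or_gt (T.gap i x) (T.height (x i)) with hi | hi
    · rw [T.push_of_le hi] at h
      exact hij (hx h)
    · have h1 := T.height_push_le (s := T.gap i x) hτ (x i)
      rw [h] at h1
      exact absurd (T.gap_le i hij.symm x) (by linarith)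
  intro i j h
  by_contra hij
  rcases le_total (T.height (x i)) (T.height (x j)) with hle | hle
  · exact key i j hij hle h
  · exact key j i (Ne.symm hij) hle h.symm

open Classical in
/-- The position of the new particle: determined by the unique particle closer to the centre than
all the others and than the ends of the legs, and at the centre if there is none. -/
noncomputable def addedPt {m : ℕ} (x : Fin m → X) : X :=
  if h : ∃ i, T.height (x i) < T.gap i x then T.newPt (T.gap h.choose x) (x h.choose)
  else T.center

lemma addedPt_eq {m : ℕ} {x : Fin m → X} {i : Fin m} (hi : T.height (x i) ≤ T.gap i x) :
    T.addedPt x = T.newPt (T.gap i x) (x i) := by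
  rw [addedPt]
  split_ifs with h
  · have hk := h.choose_spec
    have : h.choose = i := by
      by_contra hne
      linarith [T.gap_le i hne x, T.gap_le h.choose (Ne.symm hne) x]
    rw [this]
  · exact (T.newPt_of_le (T.gap_nonneg i x) (not_lt.1 fun hlt => h ⟨i, hlt⟩)).symm

lemma exists_height_le_gap {m : ℕ} (i₀ : Fin m) (x : Fin m → X) :
    ∃ i, T.height (x i) ≤ T.gap i x := by
  obtain ⟨i, -, hi⟩ := Finset.exists_min_image Finset.univ (fun i => T.height (x i))
    ⟨i₀, Finset.mem_univ i₀⟩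
  exact ⟨i, T.le_gap i (T.height_le_one _) fun j _ => hi j (Finset.mem_univ j)⟩

/-- The configurations in which the `i`-th particle is a nearest one form a closed set; these sets
cover all configurations, and on each of them `addedPt` is given by one formula. -/
lemma continuous_addedPt [T2Space X] (m : ℕ) : Continuous (T.addedPt (m := m)) := by
  rcases m.eq_zero_or_pos with rfl | hm
  · exact continuous_of_const fun x y => by rw [Subsingleton.elim x y]
  have hcl : ∀ i : Fin m, IsClosed {x | T.height (x i) ≤ T.gap i x} := fun i =>
    isClosed_le (T.height.continuous.comp (continuous_apply i)) (T.continuous_gap i)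
  refine (locallyFinite_of_finite _).continuous
    (Set.eq_univ_of_forall fun x => Set.mem_iUnion.2 (T.exists_height_le_gap ⟨0, hm⟩ x)) hcl
    fun i => ?_
  exact (T.continuous_newPt (T.continuous_gap i) (continuous_apply i) (T.gap_nonneg i)
    (T.gap_le_one i)).continuousOn.congr fun x hx => T.addedPt_eq hx

/-- Near the centre there is at most one old particle, which `push_ne_newPt` takes care of; the
others are at height at least `gap i x`, and the new one at height at most half of that. -/
lemma push_ne_addedPt {m : ℕ} {x : Fin m → X} (hx : Function.Injective x) (j : Fin m) :
    T.push 0 (T.gap j x) (x j) ≠ T.addedPt x := by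
  obtain ⟨i, hi⟩ := T.exists_height_le_gap j x
  have hpos := T.gap_pos i hx hi
  rw [T.addedPt_eq hi]
  rcases eq_or_ne j i with rfl | hji
  · exact T.push_ne_newPt hpos (T.gap_le_one _ x) (x j)
  · have h1 := T.gap_le i hji x
    rw [T.push_of_le ((T.gap_le j hji.symm x).trans (hi.trans h1))]
    intro h
    rw [h] at h1
    linarith [T.height_newPt_le hpos.le (T.gap_le_one i x) (x i)]

/-- The map `Conf m X → Conf (m + 1) X` that adds a particle near the centre. -/
noncomputable def addParticle [T2Space X] (m : ℕ) : C(Conf m X, Conf (m + 1) X) where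
  toFun x := ⟨Fin.snoc (α := fun _ => X) (fun i => T.push 0 (T.gap i x.1) (x.1 i)) (T.addedPt x.1),
    Fin.snoc_injective_iff.2 ⟨T.injective_push ⟨le_rfl, zero_le_one⟩ x.2, fun ⟨j, hj⟩ =>
      T.push_ne_addedPt x.2 j hj⟩⟩
  continuous_toFun := by
    refine Continuous.subtype_mk (Continuous.finSnoc (continuous_pi fun i => ?_) ?_) _
    · exact T.continuous_push continuous_const ((T.continuous_gap i).comp continuous_subtype_val)
        ((continuous_apply i).comp continuous_subtype_val) fun _ => T.gap_le_one i _
    · exact (T.continuous_addedPt m).comp continuous_subtype_val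

lemma forgetParticles_comp_addParticle_homotopic [T2Space X] (m : ℕ) :
    ((forgetParticles m.le_succ X).comp (T.addParticle m)).Homotopic
      (ContinuousMap.id (Conf m X)) := by
  refine ⟨⟨⟨fun p => ⟨fun i => T.push p.1 (T.gap i p.2.1) (p.2.1 i),
    T.injective_push p.1.2 p.2.2⟩, ?_⟩, fun x => ?_, fun x => ?_⟩⟩
  · refine Continuous.subtype_mk (continuous_pi fun i => ?_) _
    exact T.continuous_push (by fun_prop) ((T.continuous_gap i).comp (by fun_prop))
      ((continuous_apply i).comp (by fun_prop)) fun _ => T.gap_le_one i _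
  · refine Subtype.ext (funext fun i => ?_)
    exact (Fin.snoc_castSucc (α := fun _ => X) _ _ i).symm
  · exact Subtype.ext (funext fun i => T.push_one _ _)

end Tripod

/-- Particles are added one at a time. -/
lemma Tripod.exists_forgetParticles_comp_homotopic {X : Type u} [TopologicalSpace X] [T2Space X]
    (T : Tripod X) {m n : ℕ} (hmn : m ≤ n) :
    ∃ σ : C(Conf m X, Conf n X),
      ((forgetParticles hmn X).comp σ).Homotopic (ContinuousMap.id (Conf m X)) := by
  induction n, hmn using Nat.le_induction with
  | base => exact ⟨ContinuousMap.id _, ContinuousMap.Homotopic.refl _⟩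
  | succ n hmn ih =>
    obtain ⟨σ, hσ⟩ := ih
    refine ⟨(T.addParticle n).comp σ, ?_⟩
    have h := (ContinuousMap.Homotopic.refl (forgetParticles hmn X)).comp
      ((T.forgetParticles_comp_addParticle_homotopic n).comp (ContinuousMap.Homotopic.refl σ))
    exact h.trans hσ

/-! ### Edges of a graph -/

section Graph

variable {G : Type u} [TopologicalSpace G] [Topology.CWComplex (Set.univ : Set G)]

/-- The point at the parameter `a ∈ [-1, 1]` of an edge. -/
noncomputable def edgePoint (e : Topology.CWComplex.cell (Set.univ : Set G) 1) (a : ℝ) : G :=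
  Topology.CWComplex.map 1 e ![a]

lemma vec_mem_closedBall {a : ℝ} : (![a] : Fin 1 → ℝ) ∈ Metric.closedBall 0 1 ↔
    a ∈ Set.Icc (-1) 1 := by
  simp [pi_norm_le_iff_of_nonneg, abs_le]

lemma vec_mem_ball {a : ℝ} : (![a] : Fin 1 → ℝ) ∈ Metric.ball 0 1 ↔ a ∈ Set.Ioo (-1) 1 := by
  simp [pi_norm_lt_iff, abs_lt]

lemma continuousOn_edgePoint (e : Topology.CWComplex.cell (Set.univ : Set G) 1) :
    ContinuousOn (edgePoint e) (Set.Icc (-1) 1) :=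
  (Topology.CWComplex.continuousOn 1 e).comp (by fun_prop) fun _ ha => vec_mem_closedBall.2 ha

lemma closedCell_one_eq_image (e : Topology.CWComplex.cell (Set.univ : Set G) 1) :
    Topology.CWComplex.closedCell (C := (Set.univ : Set G)) 1 e =
      edgePoint e '' Set.Icc (-1) 1 := by
  ext x
  constructor
  · rintro ⟨y, hy, rfl⟩
    obtain ⟨a, rfl⟩ : ∃ a, y = ![a] := ⟨y 0, by ext i; fin_cases i; rfl⟩
    exact ⟨a, vec_mem_closedBall.1 hy, rfl⟩
  · rintro ⟨a, ha, rfl⟩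
    exact ⟨![a], vec_mem_closedBall.2 ha, rfl⟩

lemma edgePoint_mem_openCell (e : Topology.CWComplex.cell (Set.univ : Set G) 1) {a : ℝ}
    (ha : a ∈ Set.Ioo (-1) 1) :
    edgePoint e a ∈ Topology.CWComplex.openCell (C := (Set.univ : Set G)) 1 e :=
  ⟨![a], vec_mem_ball.2 ha, rfl⟩

lemma edgePoint_ne_vertexPoint (e : Topology.CWComplex.cell (Set.univ : Set G) 1) {a : ℝ}
    (ha : a ∈ Set.Ioo (-1) 1) (w : Topology.CWComplex.cell (Set.univ : Set G) 0) :
    edgePoint e a ≠ vertexPoint w := by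
  intro h
  have hd : Disjoint (Topology.CWComplex.openCell (C := (Set.univ : Set G)) 1 e)
      (Topology.CWComplex.openCell (C := (Set.univ : Set G)) 0 w) :=
    Topology.CWComplex.disjoint_openCell_of_ne (by simp)
  refine Set.disjoint_left.1 hd (edgePoint_mem_openCell e ha) ?_
  rw [Topology.CWComplex.openCell_zero_eq_singleton]
  exact h

lemma exists_edgePoint_eq_vertexPoint (e : Topology.CWComplex.cell (Set.univ : Set G) 1) {a : ℝ}
    (ha : a = -1 ∨ a = 1) :
    ∃ w : Topology.CWComplex.cell (Set.univ : Set G) 0, edgePoint e a = vertexPoint w := by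
  have h : edgePoint e a ∈ Topology.CWComplex.cellFrontier (C := (Set.univ : Set G)) 1 e := by
    refine ⟨![a], ?_, rfl⟩
    rcases ha with rfl | rfl <;> simp [Pi.norm_def]
  obtain ⟨x, y, hxy⟩ := Topology.CWComplex.exists_cellFrontier_one_eq e
  rw [hxy, Topology.CWComplex.closedCell_zero_eq_singleton,
    Topology.CWComplex.closedCell_zero_eq_singleton] at h
  rcases h with h | h
  exacts [⟨x, h⟩, ⟨y, h⟩]

lemma eq_of_edgePoint_eq {e e' : Topology.CWComplex.cell (Set.univ : Set G) 1} {a b : ℝ}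
    (ha : a ∈ Set.Ioo (-1) 1) (hb : b ∈ Set.Icc (-1) 1) (h : edgePoint e a = edgePoint e' b) :
    e = e' ∧ a = b := by
  by_cases hb' : b ∈ Set.Ioo (-1) 1
  · obtain rfl : e = e' := by
      by_contra hne
      have hd : Disjoint (Topology.CWComplex.openCell (C := (Set.univ : Set G)) 1 e)
          (Topology.CWComplex.openCell (C := (Set.univ : Set G)) 1 e') :=
        Topology.CWComplex.disjoint_openCell_of_ne (by simpa using hne)
      refine Set.disjoint_left.1 hd (edgePoint_mem_openCell e ha) ?_
      rw [h]
      exact edgePoint_mem_openCell e' hb'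
    have hinj := (Topology.CWComplex.map 1 e).injOn
    rw [Topology.CWComplex.source_eq] at hinj
    exact ⟨rfl, by simpa using hinj (vec_mem_ball.2 ha) (vec_mem_ball.2 hb') h⟩
  · obtain ⟨w, hw⟩ := exists_edgePoint_eq_vertexPoint e' (a := b) (by
      by_contra! hne
      exact hb' ⟨hb.1.lt_of_ne hne.1.symm, hb.2.lt_of_ne hne.2⟩)
    exact absurd (h.trans hw) (edgePoint_ne_vertexPoint e ha w)

/-- The weak topology of a graph: closedness is tested on the parameter intervals of the edges. -/
lemma isClosed_of_edges [T2Space G]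
    (hG : ∀ k : ℕ, 2 ≤ k → IsEmpty (Topology.CWComplex.cell (Set.univ : Set G) k)) {A : Set G}
    (hA : ∀ e, IsClosed {a ∈ Set.Icc (-1 : ℝ) 1 | edgePoint e a ∈ A}) : IsClosed A := by
  refine Topology.CWComplex.closed' A (Set.subset_univ A) fun n j => ?_
  change IsClosed (A ∩ Topology.CWComplex.closedCell (C := (Set.univ : Set G)) n j)
  match n, j with
  | 0, j =>
    rw [Topology.CWComplex.closedCell_zero_eq_singleton]
    exact ((Set.finite_singleton _).subset Set.inter_subset_right).isClosed
  | 1, e =>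
    have : A ∩ Topology.CWComplex.closedCell (C := (Set.univ : Set G)) 1 e =
        edgePoint e '' {a ∈ Set.Icc (-1 : ℝ) 1 | edgePoint e a ∈ A} := by
      rw [closedCell_one_eq_image]
      ext x
      constructor
      · rintro ⟨hx, a, ha, rfl⟩
        exact ⟨a, ⟨ha, hx⟩, rfl⟩
      · rintro ⟨a, ⟨ha, hx⟩, rfl⟩
        exact ⟨hx, a, ha, rfl⟩
    rw [this]
    exact ((isCompact_Icc.of_isClosed_subset (hA e) fun _ h => h.1).image_of_continuousOn
      ((continuousOn_edgePoint e).mono fun _ h => h.1)).isClosed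
  | k + 2, j => exact ((hG (k + 2) (by omega)).false j).elim

/-! ### Half-edges and the tripod at an essential vertex -/

/-- The parameter, on the interval `[-1, 1]` of an edge, of the point at the parameter
`t ∈ [0, 1]` of the half-edge at the source (`b = false`) or the target (`b = true`). The half-edges
cover only the outer quarters of the edge, so that the two of them are disjoint. -/
noncomputable def halfEdgeParam (b : Bool) (t : ℝ) : ℝ := if b then 1 - t / 2 else -1 + t / 2

lemma halfEdgeParam_mem_Icc (b : Bool) {t : ℝ} (h0 : 0 ≤ t) (h1 : t ≤ 1) :
    halfEdgeParam b t ∈ Set.Icc (-1) 1 := by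
  cases b <;> simp only [halfEdgeParam] <;> constructor <;> simp <;> linarith

lemma halfEdgeParam_mem_Ioo (b : Bool) {t : ℝ} (h0 : 0 < t) (h1 : t ≤ 1) :
    halfEdgeParam b t ∈ Set.Ioo (-1) 1 := by
  cases b <;> simp only [halfEdgeParam] <;> constructor <;> simp <;> linarith

lemma eq_of_halfEdgeParam_eq {b c : Bool} {s t : ℝ} (hs : s ≤ 1) (ht : t ≤ 1)
    (h : halfEdgeParam b s = halfEdgeParam c t) : b = c := by
  cases b <;> cases c <;> simp [halfEdgeParam] at h ⊢ <;> linarith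

/-- The half-edge at the source or the target of an edge, as an arc with parameter interval
`[0, 1]`, extended to `ℝ` by constants. -/
noncomputable def halfEdge (h : Topology.CWComplex.cell (Set.univ : Set G) 1 × Bool) : C(ℝ, G) where
  toFun t := edgePoint h.1 (halfEdgeParam h.2 (max 0 (min 1 t)))
  continuous_toFun := by
    refine (continuousOn_edgePoint h.1).comp_continuous ?_ fun t =>
      halfEdgeParam_mem_Icc h.2 (le_max_left _ _) (max_le zero_le_one (min_le_left _ _))
    unfold halfEdgeParam
    split_ifs <;> fun_prop

lemma halfEdge_apply (h : Topology.CWComplex.cell (Set.univ : Set G) 1 × Bool) {t : ℝ} (h0 : 0 ≤ t)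
    (h1 : t ≤ 1) : halfEdge h t = edgePoint h.1 (halfEdgeParam h.2 t) := by
  change edgePoint h.1 (halfEdgeParam h.2 (max 0 (min 1 t))) = _
  rw [min_eq_right h1, max_eq_right h0]

open Classical in
/-- The restriction of `vertexHeight v` to an edge, in terms of its parameter `a ∈ [-1, 1]`. -/
noncomputable def edgeHeight (v : G) (e : Topology.CWComplex.cell (Set.univ : Set G) 1) (a : ℝ) :
    ℝ :=
  min 1 (min (if edgeSource e = v then 2 * (1 + a) else 1)
    (if edgeTarget e = v then 2 * (1 - a) else 1))

open Classical in
/-- A function on the graph that vanishes only at the vertex `v`: on the half-edges at `v` it is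
their parameter, and elsewhere it is `1`. -/
noncomputable def vertexHeight (v : G) (x : G) : ℝ :=
  if h : ∃ p : Topology.CWComplex.cell (Set.univ : Set G) 1 × ℝ,
      p.2 ∈ Set.Ioo (-1) 1 ∧ edgePoint p.1 p.2 = x then edgeHeight v h.choose.1 h.choose.2
  else if x = v then 0 else 1

open Classical in
lemma vertexHeight_edgePoint (v : G) (e : Topology.CWComplex.cell (Set.univ : Set G) 1) {a : ℝ}
    (ha : a ∈ Set.Icc (-1) 1) : vertexHeight v (edgePoint e a) = edgeHeight v e a := by
  by_cases ha' : a ∈ Set.Ioo (-1) 1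
  · have h : ∃ p : Topology.CWComplex.cell (Set.univ : Set G) 1 × ℝ,
      p.2 ∈ Set.Ioo (-1) 1 ∧ edgePoint p.1 p.2 = edgePoint e a := ⟨(e, a), ha', rfl⟩
    obtain ⟨h1, h2⟩ := eq_of_edgePoint_eq h.choose_spec.1 ha h.choose_spec.2
    rw [vertexHeight, dif_pos h, h1, h2]
  · have hend : a = -1 ∨ a = 1 := by
      by_contra! hne
      exact ha' ⟨ha.1.lt_of_ne hne.1.symm, ha.2.lt_of_ne hne.2⟩
    obtain ⟨w, hw⟩ := exists_edgePoint_eq_vertexPoint e hend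
    rw [vertexHeight, dif_neg (by
      rintro ⟨p, hp, hpe⟩
      exact edgePoint_ne_vertexPoint p.1 hp w (hpe.trans hw))]
    rcases hend with rfl | rfl
    · change (if edgeSource e = v then (0 : ℝ) else 1) = _
      unfold edgeHeight
      split_ifs <;> norm_num
    · change (if edgeTarget e = v then (0 : ℝ) else 1) = _
      unfold edgeHeight
      split_ifs <;> norm_num

lemma edgeHeight_mem_Icc (v : G) (e : Topology.CWComplex.cell (Set.univ : Set G) 1) {a : ℝ}
    (ha : a ∈ Set.Icc (-1) 1) : edgeHeight v e a ∈ Set.Icc 0 1 := by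
  refine ⟨le_min zero_le_one (le_min ?_ ?_), min_le_left _ _⟩ <;> split_ifs <;>
    linarith [ha.1, ha.2]

lemma vertexHeight_mem_Icc (v x : G) : vertexHeight v x ∈ Set.Icc (0 : ℝ) 1 := by
  unfold vertexHeight
  split_ifs with h
  · exact edgeHeight_mem_Icc v _ (Set.Ioo_subset_Icc_self h.choose_spec.1)
  · simp
  · simp

lemma eq_of_vertexHeight_eq_zero (v x : G) (hx : vertexHeight v x = 0) : x = v := by
  unfold vertexHeight at hx
  split_ifs at hx with h h'
  · have ha := h.choose_spec.1
    have : 0 < edgeHeight v h.choose.1 h.choose.2 := by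
      refine lt_min zero_lt_one (lt_min ?_ ?_) <;> split_ifs <;> linarith [ha.1, ha.2]
    exact absurd hx this.ne'
  · exact h'
  · exact absurd hx one_ne_zero

lemma continuous_vertexHeight [T2Space G]
    (hG : ∀ k : ℕ, 2 ≤ k → IsEmpty (Topology.CWComplex.cell (Set.univ : Set G) k)) (v : G) :
    Continuous (vertexHeight v) := by
  refine continuous_iff_isClosed.2 fun Z hZ => isClosed_of_edges hG fun e => ?_
  have : {a ∈ Set.Icc (-1 : ℝ) 1 | edgePoint e a ∈ vertexHeight v ⁻¹' Z} =
      Set.Icc (-1) 1 ∩ edgeHeight v e ⁻¹' Z := by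
    ext a
    refine and_congr_right fun ha => ?_
    rw [Set.mem_preimage, vertexHeight_edgePoint v e ha, Set.mem_preimage]
  rw [this]
  refine isClosed_Icc.inter (hZ.preimage ?_)
  unfold edgeHeight
  split_ifs <;> fun_prop

/-- The point at which a half-edge issues. -/
noncomputable def halfEdgeBase (h : Topology.CWComplex.cell (Set.univ : Set G) 1 × Bool) : G :=
  if h.2 then edgeTarget h.1 else edgeSource h.1

lemma vertexHeight_halfEdge {v : G} {h : Topology.CWComplex.cell (Set.univ : Set G) 1 × Bool}
    (hv : halfEdgeBase h = v) {t : ℝ} (h0 : 0 ≤ t) (h1 : t ≤ 1) :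
    vertexHeight v (halfEdge h t) = t := by
  obtain ⟨e, b⟩ := h
  rw [halfEdge_apply _ h0 h1, vertexHeight_edgePoint v e (halfEdgeParam_mem_Icc b h0 h1)]
  cases b
  · have hv' : edgeSource e = v := by simpa [halfEdgeBase] using hv
    simp only [edgeHeight, halfEdgeParam, if_pos hv', Bool.false_eq_true, if_false]
    split_ifs <;> rw [min_eq_right ((min_le_left _ _).trans (by linarith)),
      min_eq_left (by linarith)] <;> ring
  · have hv' : edgeTarget e = v := by simpa [halfEdgeBase] using hv
    simp only [edgeHeight, halfEdgeParam, if_pos hv', if_true]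
    split_ifs <;> rw [min_eq_right ((min_le_right _ _).trans (by linarith)),
      min_eq_right (by linarith)] <;> ring

lemma isOpen_image_halfEdge [T2Space G]
    (hG : ∀ k : ℕ, 2 ≤ k → IsEmpty (Topology.CWComplex.cell (Set.univ : Set G) k))
    (h : Topology.CWComplex.cell (Set.univ : Set G) 1 × Bool) :
    IsOpen (halfEdge h '' Set.Ioo 0 1) := by
  rw [← isClosed_compl_iff]
  refine isClosed_of_edges hG fun e => ?_
  have hopen : IsOpen (halfEdgeParam h.2 '' Set.Ioo 0 1) := by
    obtain ⟨e, b⟩ := h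
    cases b
    · have : halfEdgeParam false '' Set.Ioo 0 1 = Set.Ioo (-1) (-1 / 2) := by
        ext a
        simp only [halfEdgeParam, Set.mem_image, Set.mem_Ioo, Bool.false_eq_true, if_false]
        exact ⟨by rintro ⟨t, ht, rfl⟩; constructor <;> linarith, fun ha =>
          ⟨2 * (a + 1), ⟨by linarith, by linarith⟩, by ring⟩⟩
      exact this ▸ isOpen_Ioo
    · have : halfEdgeParam true '' Set.Ioo 0 1 = Set.Ioo (1 / 2) 1 := by
        ext a
        simp only [halfEdgeParam, Set.mem_image, Set.mem_Ioo, if_true]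
        exact ⟨by rintro ⟨t, ht, rfl⟩; constructor <;> linarith, fun ha =>
          ⟨2 * (1 - a), ⟨by linarith, by linarith⟩, by ring⟩⟩
      exact this ▸ isOpen_Ioo
  by_cases he : h.1 = e
  · have : {a ∈ Set.Icc (-1 : ℝ) 1 | edgePoint e a ∈ (halfEdge h '' Set.Ioo 0 1)ᶜ} =
        Set.Icc (-1) 1 ∩ (halfEdgeParam h.2 '' Set.Ioo 0 1)ᶜ := by
      ext a
      refine and_congr_right fun ha => not_congr ⟨?_, ?_⟩
      · rintro ⟨t, ht, hta⟩
        rw [halfEdge_apply _ ht.1.le ht.2.le] at hta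
        exact ⟨t, ht, (eq_of_edgePoint_eq (halfEdgeParam_mem_Ioo h.2 ht.1 ht.2.le) ha hta).2⟩
      · rintro ⟨t, ht, rfl⟩
        exact ⟨t, ht, by rw [halfEdge_apply _ ht.1.le ht.2.le, he]⟩
    rw [this]
    exact isClosed_Icc.inter hopen.isClosed_compl
  · have : {a ∈ Set.Icc (-1 : ℝ) 1 | edgePoint e a ∈ (halfEdge h '' Set.Ioo 0 1)ᶜ} =
        Set.Icc (-1) 1 := by
      ext a
      refine and_iff_left_of_imp fun ha => ?_
      rintro ⟨t, ht, hta⟩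
      rw [halfEdge_apply _ ht.1.le ht.2.le] at hta
      exact he (eq_of_edgePoint_eq (halfEdgeParam_mem_Ioo h.2 ht.1 ht.2.le) ha hta).1
    rw [this]
    exact isClosed_Icc

/-- Three distinct half-edges at the same point form a tripod. -/
noncomputable def halfEdgeTripod [T2Space G]
    (hG : ∀ k : ℕ, 2 ≤ k → IsEmpty (Topology.CWComplex.cell (Set.univ : Set G) k)) (v : G)
    (h : Fin 3 → Topology.CWComplex.cell (Set.univ : Set G) 1 × Bool) (hinj : Function.Injective h)
    (hv : ∀ j, halfEdgeBase (h j) = v) : Tripod G where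
  leg j := halfEdge (h j)
  height := ⟨vertexHeight v, continuous_vertexHeight hG v⟩
  height_nonneg x := (vertexHeight_mem_Icc v x).1
  height_le_one x := (vertexHeight_mem_Icc v x).2
  height_leg j _ h0 h1 := vertexHeight_halfEdge (hv j) h0 h1
  eq_of_height_eq_zero x y hx hy :=
    (eq_of_vertexHeight_eq_zero v x hx).trans (eq_of_vertexHeight_eq_zero v y hy).symm
  leg_ne j k t t' hjk h0 h1 h0' h1' heq := by
    rw [halfEdge_apply _ h0.le h1, halfEdge_apply _ h0' h1'] at heq
    obtain ⟨he, ha⟩ := eq_of_edgePoint_eq (halfEdgeParam_mem_Ioo _ h0 h1)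
      (halfEdgeParam_mem_Icc _ h0' h1') heq
    exact hjk (hinj (Prod.ext he (eq_of_halfEdgeParam_eq h1 h1' ha)))
  isOpen_leg := isOpen_image_halfEdge hG (h 0)

lemma exists_three_halfEdges [Finite (Topology.CWComplex.cell (Set.univ : Set G) 1)]
    {w : Topology.CWComplex.cell (Set.univ : Set G) 0} (hw : IsEssential w) :
    ∃ h : Fin 3 → Topology.CWComplex.cell (Set.univ : Set G) 1 × Bool, Function.Injective h ∧
      ∀ j, halfEdgeBase (h j) = vertexPoint w := by
  let A : Bool → Set (Topology.CWComplex.cell (Set.univ : Set G) 1 × Bool) := fun b =>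
    (fun e => (e, b)) '' {e | halfEdgeBase (e, b) = vertexPoint w}
  have hA : ∀ b, (A b).ncard = {e | halfEdgeBase (e, b) = vertexPoint w}.ncard := fun b =>
    Set.ncard_image_of_injective _ fun _ _ h => congrArg Prod.fst h
  have hdisj : Disjoint (A false) (A true) := by
    rw [Set.disjoint_left]
    rintro _ ⟨e, -, rfl⟩ ⟨e', -, h⟩
    simp at h
  have hcard : 3 ≤ (A false ∪ A true).ncard := by
    rw [Set.ncard_union_eq hdisj, hA, hA]
    exact hw
  obtain ⟨t, ht, ht3⟩ := Set.exists_subset_card_eq hcard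
  have := Nat.card_coe_set_eq t
  let ε := (Finite.equivFinOfCardEq (this.trans ht3)).symm
  refine ⟨fun j => (ε j).1, Subtype.val_injective.comp ε.injective, fun j => ?_⟩
  rcases ht (ε j).2 with ⟨e, he, h⟩ | ⟨e, he, h⟩ <;> exact (congrArg halfEdgeBase h).symm.trans he

lemma nonempty_tripod [IsFiniteConnectedGraph G]
    {w : Topology.CWComplex.cell (Set.univ : Set G) 0} (hw : IsEssential w) :
    Nonempty (Tripod G) := by
  have := IsFiniteConnectedGraph.t2 (G := G)
  have := IsFiniteConnectedGraph.finite (G := G)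
  have : Finite (Topology.CWComplex.cell (Set.univ : Set G) 1) :=
    Topology.CWComplex.FiniteType.finite_cell (C := (Set.univ : Set G)) 1
  obtain ⟨h, hinj, hv⟩ := exists_three_halfEdges hw
  exact ⟨halfEdgeTripod IsFiniteConnectedGraph.isEmpty_cell _ h hinj hv⟩

end Graph

/-! ### Homology -/

lemma singularHMap_comp {R : Type v} [Ring R] (M : ModuleCat.{max u v} R) (i : ℕ)
    {X Y Z : Type u} [TopologicalSpace X] [TopologicalSpace Y] [TopologicalSpace Z] (f : C(X, Y))
    (g : C(Y, Z)) : singularHMap M i (g.comp f) = singularHMap M i f ≫ singularHMap M i g :=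
  ((AlgebraicTopology.singularHomologyFunctor.{u} (ModuleCat.{max u v} R) i).obj M).map_comp
    (TopCat.ofHom f) (TopCat.ofHom g)

lemma singularHMap_id {R : Type v} [Ring R] (M : ModuleCat.{max u v} R) (i : ℕ)
    (X : Type u) [TopologicalSpace X] : singularHMap M i (ContinuousMap.id X) = 𝟙 _ :=
  ((AlgebraicTopology.singularHomologyFunctor.{u} (ModuleCat.{max u v} R) i).obj M).map_id
    (TopCat.of X)

lemma singularHMap_eq_of_homotopic {R : Type v} [Ring R] (M : ModuleCat.{max u v} R) (i : ℕ)
    {X Y : Type u} [TopologicalSpace X] [TopologicalSpace Y] {f g : C(X, Y)} (h : f.Homotopic g) :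
    singularHMap M i f = singularHMap M i g :=
  TopCat.Homotopy.congr_homologyMap_singularChainComplexFunctor
    (f := TopCat.ofHom f) (g := TopCat.ofHom g) h.some M i

/-- A split monomorphism is the inclusion of a direct summand, complemented by the kernel of the
retraction. -/
lemma exists_biprod_iso_of_comp_eq_id {C : Type*} [Category C] [Abelian C] {A B : C} (f : A ⟶ B)
    (g : B ⟶ A) (hfg : f ≫ g = 𝟙 A) :
    ∃ (K : C) (φ : B ≅ A ⊞ K), f ≫ φ.hom = biprod.inl ∧ φ.hom ≫ biprod.fst = g := by
  refine ⟨kernel g, ⟨biprod.lift g (kernel.lift g (𝟙 B - g ≫ f) (by simp [hfg])),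
    biprod.desc f (kernel.ι g), ?_, ?_⟩, ?_, ?_⟩
  · simp [biprod.lift_desc]
  · ext <;> simp [hfg, reassoc_of% hfg]
  · ext <;> simp [hfg, reassoc_of% hfg]
  · simp

theorem mainTheorem7 (G : Type u) [TopologicalSpace G] [Topology.CWComplex (Set.univ : Set G)]
    [IsFiniteConnectedGraph G]
    (hG : ∃ w : Topology.CWComplex.cell (Set.univ : Set G) 0, IsEssential w)
    (m n : ℕ) (hmn : m ≤ n) :
    ∃ σ : C(Conf m G, Conf n G),
      ((forgetParticles hmn G).comp σ).Homotopic (ContinuousMap.id (Conf m G)) ∧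
      ∀ (R : Type v) [Ring R] (M : ModuleCat.{max u v} R) (i : ℕ),
        ∃ (K : ModuleCat.{max u v} R) (φ : singularH M i (Conf n G) ≅ singularH M i (Conf m G) ⊞ K),
          singularHMap M i σ ≫ φ.hom = biprod.inl ∧
          φ.hom ≫ biprod.fst = singularHMap M i (forgetParticles hmn G) := by
  have := IsFiniteConnectedGraph.t2 (G := G)
  obtain ⟨w, hw⟩ := hG
  obtain ⟨T⟩ := nonempty_tripod hw
  obtain ⟨σ, hσ⟩ := T.exists_forgetParticles_comp_homotopic hmn
  refine ⟨σ, hσ, fun R _ M i => exists_biprod_iso_of_comp_eq_id _ _ ?_⟩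
  rw [← singularHMap_comp, singularHMap_eq_of_homotopic M i hσ, singularHMap_id]
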